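/- For an integer $r\ge 5$ consider a deck of $4r$ cards with $r$ ranks and four suits (each rank occurs once in each suit), and let $S_r$ be the set of its seven-card subsets. The ranks are linearly ordered with the ace at the top, and in straights the ace may also be used as the lowest rank; so a straight consists of five cards whose ranks are five consecutive terms of the list (ace, $2$nd rank, …, $r$-th rank, ace). The hand types are high card (HC), one pair (1P), two pair (2P), three of a kind (3X), straight (ST), flush (FL), full house (FH), four of a kind (4X) and straight flush (SF). They are read inclusively: five cards contain every type whose defining pattern they exhibit (for example, a full house contains 3X, 2P, 1P and HC; every five cards contain HC), and 4X counts as containing 2P. For $s\in S_r$ write $h\in s$ if some five of the seven cards of $s$ contain a hand of type $h$. Let $\mathrm{freq}_r(h)=|\{s\in S_r : h\in s\}|$. In the *frequency ranking* $h_0$ ranks above $h_1$ exactly when $\mathrm{freq}_r(h_0)<\mathrm{freq}_r(h_1)$. Let $\mathrm{sd}_r(h)$ be the *showdown frequency* of $h$ with respect to the frequency ranking: the number of $s\in S_r$ such that $h\in s$ and $h'\notin s$ for every type $h'$ that ranks above $h$ in the frequency ranking. In the *showdown ranking* $h_0$ ranks above $h_1$ exactly when $\mathrm{sd}_r(h_0)<\mathrm{sd}_r(h_1)$.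 Then $r=13$ is the smallest integer $r\ge 5$ for which the showdown ranking and the frequency ranking agree on all hand types other than HC, that is, $\mathrm{sd}_r(h_0)<\mathrm{sd}_r(h_1)$ if and only if $\mathrm{freq}_r(h_0)<\mathrm{freq}_r(h_1)$ for all $h_0,h_1\ne \mathrm{HC}$. (For $r=13$ the two rankings of all nine types, HC included, are different.) At $r=9$, for example, they disagree: $\mathrm{freq}_9(\mathrm{2P})<\mathrm{freq}_9(\mathrm{1P})$ but $\mathrm{sd}_9(\mathrm{1P})<\mathrm{sd}_9(\mathrm{2P})$, and $\mathrm{freq}_9(\mathrm{FH})<\mathrm{freq}_9(\mathrm{3X})$ but $\mathrm{sd}_9(\mathrm{3X})<\mathrm{sd}_9(\mathrm{FH})$. -/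

import Mathlib

namespace Poker

/-- A card of the deck with `r` ranks and four suits: a pair (rank, suit).
Rank `0` is the ace, which is adjacent both to rank `1` (low) and to rank `r - 1` (high). -/
abbrev Card (r : ℕ) : Type := Fin r × Fin 4

/-- The nine hand types. -/
inductive HandType where
  | highCard
  | onePair
  | twoPair
  | threeOfAKind
  | straight
  | flush
  | fullHouse
  | fourOfAKind
  | straightFlush
  deriving DecidableEq

/-- The number of cards of rank `a` in `t`. -/
def rankCount {r : ℕ} (t : Finset (Card r)) (a : Fin r) : ℕ :=
  (t.filter (fun c => c.1 = a)).card

/-- Five consecutive ranks `k, k+1, …, k+4` occur in `t`, where the ranks are listed as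
`0, 1, …, r - 1, r` and both ends `0` and `r` of this list stand for the ace. -/
def HasStraight {r : ℕ} (t : Finset (Card r)) : Prop :=
  ∃ k : ℕ, k + 4 ≤ r ∧ ∀ j < 5, ∃ c ∈ t, (c.1 : ℕ) = (k + j) % r

/-- All cards of `t` have the same suit. -/
def OneSuit {r : ℕ} (t : Finset (Card r)) : Prop :=
  ∃ u : Fin 4, ∀ c ∈ t, c.2 = u

/-- `FiveCard h t`: the five-card set `t` contains a hand of type `h`.  This is inclusive
(a full house also contains three of a kind, two pair, one pair and a high card), and
four of a kind counts as containing two pair. -/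
def FiveCard {r : ℕ} (h : HandType) (t : Finset (Card r)) : Prop :=
  match h with
  | .highCard => True
  | .onePair => ∃ a, 2 ≤ rankCount t a
  | .twoPair => (∃ a b, a ≠ b ∧ 2 ≤ rankCount t a ∧ 2 ≤ rankCount t b) ∨ ∃ a, 4 ≤ rankCount t a
  | .threeOfAKind => ∃ a, 3 ≤ rankCount t a
  | .straight => HasStraight t
  | .flush => OneSuit t
  | .fullHouse => ∃ a b, a ≠ b ∧ 3 ≤ rankCount t a ∧ 2 ≤ rankCount t b
  | .fourOfAKind => ∃ a, 4 ≤ rankCount t a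
  | .straightFlush => HasStraight t ∧ OneSuit t

/-- The set of all seven-card hands from the deck with `r` ranks. -/
def hands (r : ℕ) : Finset (Finset (Card r)) :=
  (Finset.univ : Finset (Card r)).powersetCard 7

/-- The relation `h ∈ s`: some five of the cards of `s` contain a hand of type `h`. -/
def Contains {r : ℕ} (s : Finset (Card r)) (h : HandType) : Prop :=
  ∃ t ⊆ s, t.card = 5 ∧ FiveCard h t

open Classical in
/-- The number of seven-card hands that contain the hand type `h`. -/
noncomputable def freq (r : ℕ) (h : HandType) : ℕ :=
  ((hands r).filter (fun s => Contains s h)).card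

/-- A ranking of the hand types: `rk h₀ h₁` means that `h₀` ranks above `h₁`. -/
abbrev Ranking : Type := HandType → HandType → Prop

/-- The frequency ranking: the rarer type ranks higher. -/
def freqRanking (r : ℕ) : Ranking :=
  fun h₀ h₁ => freq r h₀ < freq r h₁

open Classical in
/-- The showdown frequency of `h` with respect to the ranking `rk`: the number of seven-card
hands that contain `h` and contain no type that ranks above `h`. -/
noncomputable def showdownFreq (r : ℕ) (rk : Ranking) (h : HandType) : ℕ :=
  ((hands r).filter (fun s => Contains s h ∧ ∀ h', rk h' h → ¬ Contains s h')).card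

/-- The showdown ranking obtained from the ranking `rk`: the type that is shown down less
often ranks higher. -/
def showdownRanking (r : ℕ) (rk : Ranking) : Ranking :=
  fun h₀ h₁ => showdownFreq r rk h₀ < showdownFreq r rk h₁

/-- Two rankings order all the hand types other than the high card in the same way. -/
def AgreeExceptHighCard (rk rk' : Ranking) : Prop :=
  ∀ h₀ h₁ : HandType, h₀ ≠ .highCard → h₁ ≠ .highCard → (rk h₀ h₁ ↔ rk' h₀ h₁)

end Poker

/-!
Whether seven cards contain a given hand type depends on little: the numbers of ranks held at least
twice, three times and four times, whether the set of occurring ranks contains five consecutive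
ones, and, for each suit, the number of ranks occurring in that suit and whether they contain five
consecutive ones (`contains_iff_containsType`).  Everything except consecutiveness is an additive
statistic of the function that sends a rank to the set of its suits in the hand.

Seven cards have a flush in at most one suit.  Hence the indicator of a combination of hand types
is the value it would have without any flush, plus one correction for each suit that has a flush,
plus one correction for each suit that has a straight flush (`indicator_eq_add_sum`).  The first two
terms see consecutiveness only in the set of all ranks of the hand, the last one only in the set of
ranks of one suit.  Once that set of ranks is fixed, the remaining count is a coefficient extraction
from a product of powers of two generating functions, and it depends only on the size of the set
(`sum_piFinset_eq_functional`, `sum_ranks_eq`, `sum_suitRanks_eq`).  So the number of hands that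
contain one type and avoid others is an explicit expression `handCount` in the numbers of `k`-element
sets of ranks with five consecutive members (`card_filter_eq_handCount`).  These numbers are found by
running through bit masks (`straightSets_eq_countMasks`), and the generating functions are multiplied
as weighted lists truncated at seven cards (`truncEq_truncPow`), so that all frequencies and showdown
frequencies are evaluated in the kernel.

For `r = 13` the resulting tables agree except at the high card.  For `5 ≤ r ≤ 9` one pair is more
frequent than two pair but is shown down less often, and for `10 ≤ r ≤ 12` the same holds for three
of a kind and the straight.
-/

namespace Poker

/-! ### Truncated products of generating functions -/

section WeightedList
variable {M : Type*}

/-- The value at `F` of the weighted list `H`, read as the formal sum `∑ c • v`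
over the entries `(c, v)` of `H`. -/
def evalAt (F : M → ℤ) (H : List (ℕ × M)) : ℤ :=
  (H.map fun p => (p.1 : ℤ) * F p.2).sum

/-- Add the entry `(c, v)` to a weighted list, merging it with an entry of the same value. -/
def addEntry [DecidableEq M] (c : ℕ) (v : M) : List (ℕ × M) → List (ℕ × M)
  | [] => [(c, v)]
  | (d, w) :: H => if v = w then (c + d, w) :: H else (d, w) :: addEntry c v H

/-- Product of two weighted lists, read as formal sums over `M`.  Values that fail `light` are
dropped. -/
def truncMul [DecidableEq M] [Add M] (light : M → Bool) (L H : List (ℕ × M)) : List (ℕ × M) :=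
  L.foldr (fun p acc => H.foldr (fun q acc =>
    if light (p.2 + q.2) then addEntry (p.1 * q.1) (p.2 + q.2) acc else acc) acc) []

/-- The product of `m` factors `L` and `n` factors `L'`, without the values that fail `light`. -/
def truncPow [DecidableEq M] [AddMonoid M] (light : M → Bool) (L L' : List (ℕ × M)) (m n : ℕ) :
    List (ℕ × M) :=
  (truncMul light L')^[n] ((truncMul light L)^[m] [(1, 0)])

/-- The element of the monoid algebra that a weighted list stands for. -/
noncomputable def toAlg (H : List (ℕ × M)) : AddMonoidAlgebra ℤ M :=
  (H.map fun p => AddMonoidAlgebra.single p.2 (p.1 : ℤ)).sum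

/-- The linear functional on the monoid algebra with value `F v` at the monomial `v`. -/
noncomputable def functional (F : M → ℤ) : AddMonoidAlgebra ℤ M →+ ℤ :=
  AddMonoidAlgebra.liftNC (AddMonoidHom.id ℤ) (fun v => F v.toAdd)

lemma functional_single (F : M → ℤ) (v : M) (c : ℤ) :
    functional F (AddMonoidAlgebra.single v c) = c * F v := by
  simp [functional, AddMonoidAlgebra.liftNC_single]

lemma functional_toAlg (F : M → ℤ) (H : List (ℕ × M)) :
    functional F (toAlg H) = evalAt F H := by
  simp [toAlg, evalAt, map_list_sum, Function.comp_def, functional_single]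

lemma toAlg_cons (p : ℕ × M) (H : List (ℕ × M)) :
    toAlg (p :: H) = AddMonoidAlgebra.single p.2 (p.1 : ℤ) + toAlg H := by
  simp [toAlg]

lemma toAlg_addEntry [DecidableEq M] (c : ℕ) (v : M) (H : List (ℕ × M)) :
    toAlg (addEntry c v H) = AddMonoidAlgebra.single v (c : ℤ) + toAlg H := by
  induction H with
  | nil => simp [addEntry, toAlg]
  | cons p H ih =>
    unfold addEntry
    split_ifs with h
    · simp [toAlg_cons, h, AddMonoidAlgebra.single_add, add_assoc]
    · rw [toAlg_cons, toAlg_cons, ih]; abel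

/-- A weighted list with an entry `(c, v)` stands for `c` equal summands `v`. -/
lemma toAlg_eq_sum {α : Type*} (w : α → M) (A : Finset α) (L : List (ℕ × M))
    (h : A.val.map w = ((L.flatMap fun p => List.replicate p.1 p.2 : List M) : Multiset M)) :
    toAlg L = ∑ a ∈ A, AddMonoidAlgebra.single (w a) (1 : ℤ) := by
  have h1 : ∑ a ∈ A, AddMonoidAlgebra.single (w a) (1 : ℤ) =
      ((A.val.map w).map fun v => AddMonoidAlgebra.single v (1 : ℤ)).sum := by
    rw [Multiset.map_map]; rfl
  rw [h1, h]
  clear h h1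
  rw [Multiset.map_coe, Multiset.sum_coe]
  induction L with
  | nil => simp [toAlg]
  | cons p L ih =>
    rw [toAlg_cons, ih, List.flatMap_cons, List.map_append, List.sum_append, List.map_replicate,
      List.sum_replicate, AddMonoidAlgebra.smul_single]
    simp

variable [AddCommMonoid M]

lemma functional_single_mul (F : M → ℤ) (a : M) (c : ℤ) (x : AddMonoidAlgebra ℤ M) :
    functional F (AddMonoidAlgebra.single a c * x) = c * functional (fun v => F (a + v)) x := by
  induction x using AddMonoidAlgebra.induction_linear with
  | zero => simp
  | add x y hx hy => rw [mul_add, map_add, map_add, hx, hy, mul_add]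
  | single b d => rw [AddMonoidAlgebra.single_mul_single, functional_single, functional_single,
      mul_assoc]

/-- Equality of formal sums up to terms at values that fail `light`. -/
def TruncEq (light : M → Bool) (x y : AddMonoidAlgebra ℤ M) : Prop :=
  ∀ F : M → ℤ, (∀ v, light v = false → F v = 0) → functional F x = functional F y

/-- Since every value above one that fails `light` fails it too, truncation is compatible with
multiplication. -/
lemma TruncEq.mul_left {light : M → Bool}
    (hl : ∀ a v, light (a + v) = true → light v = true) {x y : AddMonoidAlgebra ℤ M}
    (h : TruncEq light x y) (z : AddMonoidAlgebra ℤ M) : TruncEq light (z * x) (z * y) := by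
  intro F hF
  induction z using AddMonoidAlgebra.induction_linear with
  | zero => simp
  | add z w hz hw => rw [add_mul, add_mul, map_add, map_add, hz, hw]
  | single a c =>
    rw [functional_single_mul, functional_single_mul, h]
    intro v hv
    apply hF
    by_contra h'
    simp [hl a v (by simpa using h')] at hv

lemma truncEq_truncMul [DecidableEq M] (light : M → Bool) (L H : List (ℕ × M)) :
    TruncEq light (toAlg L * toAlg H) (toAlg (truncMul light L H)) := by
  intro F hF
  have inner : ∀ (p : ℕ × M) (acc : List (ℕ × M)),
      functional F (toAlg (H.foldr (fun q acc =>
        if light (p.2 + q.2) then addEntry (p.1 * q.1) (p.2 + q.2) acc else acc) acc)) =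
      functional F (AddMonoidAlgebra.single p.2 (p.1 : ℤ) * toAlg H) + functional F (toAlg acc) := by
    intro p acc
    induction H with
    | nil => simp [toAlg]
    | cons q H ih =>
      rw [List.foldr_cons, toAlg_cons, mul_add, map_add, AddMonoidAlgebra.single_mul_single,
        functional_single, add_assoc, ← ih]
      split_ifs with h
      · rw [toAlg_addEntry, map_add, functional_single]; push_cast; rfl
      · rw [hF _ (by simpa using h)]; simp
  unfold truncMul
  induction L with
  | nil => simp [toAlg]
  | cons p L ih => rw [List.foldr_cons, inner, toAlg_cons, add_mul, map_add, ih]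

lemma truncEq_truncPow [DecidableEq M] {light : M → Bool}
    (hl : ∀ a v, light (a + v) = true → light v = true) (L L' : List (ℕ × M)) (m n : ℕ) :
    TruncEq light (toAlg L ^ m * toAlg L' ^ n) (toAlg (truncPow light L L' m n)) := by
  have step : ∀ (K H : List (ℕ × M)) (x : AddMonoidAlgebra ℤ M), TruncEq light x (toAlg H) →
      TruncEq light (toAlg K * x) (toAlg (truncMul light K H)) := fun K H x h F hF =>
    (h.mul_left hl (toAlg K) F hF).trans (truncEq_truncMul light K H F hF)
  have iter : ∀ (K H : List (ℕ × M)) (x : AddMonoidAlgebra ℤ M), TruncEq light x (toAlg H) →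
      ∀ k : ℕ, TruncEq light (toAlg K ^ k * x) (toAlg ((truncMul light K)^[k] H)) := by
    intro K H x h k
    induction k with
    | zero => simpa using h
    | succ k ih =>
      rw [pow_succ', mul_assoc, Function.iterate_succ_apply']
      exact step _ _ _ ih
  rw [mul_comm]
  refine iter _ _ _ ?_ n
  rw [← mul_one (toAlg L ^ m)]
  -- The empty product is the formal sum with the single entry `(1, 0)`.
  exact iter _ _ _ (fun F _ => by simp [toAlg, AddMonoidAlgebra.one_def]) m

/-- A sum over functions whose values lie in `A` on the set `S` and in `B` off `S`, of a quantity
that depends only on an additive statistic, is read off from a product of powers of the generating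
functions of `A` and `B`. -/
theorem sum_piFinset_eq_functional {ι α : Type*} [Fintype ι] [DecidableEq ι]
    (w : α → M) (A B : Finset α) (L L' : List (ℕ × M))
    (hA : A.val.map w = ((L.flatMap fun p => List.replicate p.1 p.2 : List M) : Multiset M))
    (hB : B.val.map w = ((L'.flatMap fun p => List.replicate p.1 p.2 : List M) : Multiset M))
    (S : Finset ι) (F : M → ℤ) :
    ∑ f ∈ Fintype.piFinset (fun i => if i ∈ S then A else B), F (∑ i, w (f i)) =
      functional F (toAlg L ^ S.card * toAlg L' ^ (Fintype.card ι - S.card)) := by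
  rw [toAlg_eq_sum w A L hA, toAlg_eq_sum w B L' hB]
  have hprod : (∑ a ∈ A, AddMonoidAlgebra.single (w a) (1 : ℤ)) ^ S.card *
      (∑ a ∈ B, AddMonoidAlgebra.single (w a) (1 : ℤ)) ^ (Fintype.card ι - S.card) =
      ∏ i : ι, ∑ a ∈ (if i ∈ S then A else B), AddMonoidAlgebra.single (w a) (1 : ℤ) := by
    rw [← Finset.prod_mul_prod_compl S, ← Finset.card_compl]
    congr 1
    · rw [Finset.prod_congr rfl (fun i hi => by rw [if_pos hi]), Finset.prod_const]
    · rw [Finset.prod_congr rfl (fun i hi => by rw [if_neg (Finset.mem_compl.1 hi)]),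
        Finset.prod_const]
  rw [hprod, Finset.prod_univ_sum, map_sum]
  refine Finset.sum_congr rfl fun f _ => ?_
  rw [AddMonoidAlgebra.prod_single, functional_single]
  simp

lemma truncMul_nil [DecidableEq M] (light : M → Bool) (L : List (ℕ × M)) :
    truncMul light L [] = [] := by
  induction L with
  | nil => rfl
  | cons p L ih => simp [truncMul]

/-- If `m` factors `L` already exceed the truncation, so does any product with more of them. -/
lemma truncPow_eq_nil [DecidableEq M] {light : M → Bool} {L : List (ℕ × M)} {m : ℕ}
    (h : truncPow light L [] m 0 = []) (L' : List (ℕ × M)) {k : ℕ} (hk : m ≤ k) (n : ℕ) :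
    truncPow light L L' k n = [] := by
  have nil : ∀ (K : List (ℕ × M)) (j : ℕ), (truncMul light K)^[j] [] = [] := fun K j =>
    Function.iterate_fixed (truncMul_nil light K) j
  obtain ⟨d, rfl⟩ := Nat.exists_eq_add_of_le' hk
  have h' : (truncMul light L)^[m] [(1, 0)] = [] := h
  rw [truncPow, Function.iterate_add_apply, h', nil, nil]

end WeightedList

/-! ### The counting formula -/

/-- Additive data of a set of cards: the number of cards, the numbers of ranks with at least two,
three and four cards, and the number of cards of one selected suit. -/
abbrev Stat : Type := ℕ × ℕ × ℕ × ℕ × ℕ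

/-- The data of `m` cards of one rank, `b` of which are of the selected suit. -/
def rankStat (m b : ℕ) : Stat :=
  (m, if 2 ≤ m then 1 else 0, if 3 ≤ m then 1 else 0, if 4 ≤ m then 1 else 0, b)

/-- The data are those of at most seven cards. -/
def AtMostSeven (v : Stat) : Bool := v.1 ≤ 7

/-- The sets of suits that contain the selected suit, sorted by their data. -/
def withSuit : List (ℕ × Stat) :=
  [(1, rankStat 1 1), (3, rankStat 2 1), (3, rankStat 3 1), (1, rankStat 4 1)]

/-- The nonempty sets of suits that do not contain the selected suit, sorted by their data. -/
def offSuit : List (ℕ × Stat) :=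
  [(3, rankStat 1 0), (3, rankStat 2 0), (1, rankStat 3 0)]

/-- The empty set of suits with its data. -/
def noSuit : List (ℕ × Stat) := [(1, rankStat 0 0)]

/-- The sets of at most seven cards in which exactly `k` given ranks occur, sorted by their
data. -/
def bySupport (k : ℕ) : List (ℕ × Stat) := truncPow AtMostSeven (withSuit ++ offSuit) noSuit k 0

/-- The sets of at most seven cards from `m + n` ranks in which exactly `m` given ranks occur in
the selected suit, sorted by their data. -/
def bySuitRanks (m n : ℕ) : List (ℕ × Stat) :=
  truncPow AtMostSeven withSuit (noSuit ++ offSuit) m n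

/-- Whether a hand with data `v` contains a type; the flags tell whether it contains a straight,
a flush and a straight flush. -/
def containsType (v : Stat) (st fl sf : Bool) : HandType → Bool
  | .highCard => true
  | .onePair => 1 ≤ v.2.1
  | .twoPair => 2 ≤ v.2.1 || 1 ≤ v.2.2.2.1
  | .threeOfAKind => 1 ≤ v.2.2.1
  | .straight => st
  | .flush => fl
  | .fullHouse => 1 ≤ v.2.2.1 && 2 ≤ v.2.1
  | .fourOfAKind => 1 ≤ v.2.2.2.1
  | .straightFlush => sf

/-- The indicator of the seven-card hands that contain `h` and none of the types in `ex`. -/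
def indicator (h : HandType) (ex : List HandType) (v : Stat) (st fl sf : Bool) : ℤ :=
  if v.1 = 7 ∧ containsType v st fl sf h ∧ ∀ h' ∈ ex, containsType v st fl sf h' = false
  then 1 else 0

/-- The change of `indicator` caused by a flush in the selected suit. -/
def flushCorrection (h : HandType) (ex : List HandType) (st : Bool) (v : Stat) : ℤ :=
  if 5 ≤ v.2.2.2.2 then indicator h ex v st true false - indicator h ex v st false false else 0

/-- The change of `indicator` when a straight and a flush are replaced by a straight flush. -/
def straightFlushCorrection (h : HandType) (ex : List HandType) (v : Stat) : ℤ :=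
  indicator h ex v true true true - indicator h ex v true true false

/-- The number of seven-card hands that contain `h` and none of the types in `ex`, in terms of the
numbers `A k` of sets of `k` ranks that contain five consecutive ones.  The first two summands run
over the sets of ranks of the hand, with and without a straight, and the third over the sets of
ranks in the suit of a straight flush; the factors `4` count the suits.  The case distinction on
`A k = 0` only spares evaluating `bySuitRanks` for few ranks. -/
def handCount (A : ℕ → ℕ) (r : ℕ) (h : HandType) (ex : List HandType) : ℤ :=
  ∑ k ∈ Finset.range 8,
    (A k * evalAt (fun v => indicator h ex v true false false + 4 * flushCorrection h ex true v)
        (bySupport k) +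
      ((r.choose k : ℤ) - A k) *
        evalAt (fun v => indicator h ex v false false false + 4 * flushCorrection h ex false v)
        (bySupport k) +
      if A k = 0 then 0 else
        4 * (A k * evalAt (straightFlushCorrection h ex) (bySuitRanks k (r - k))))

section Hands

variable {r : ℕ}

/-! ### The hand types contained in seven cards -/

/-- The suits in which the rank `a` occurs in `s`. -/
def suitsOf (s : Finset (Card r)) (a : Fin r) : Finset (Fin 4) :=
  Finset.univ.filter fun u => (a, u) ∈ s

@[simp] lemma mem_suitsOf {s : Finset (Card r)} {a : Fin r} {u : Fin 4} :
    u ∈ suitsOf s a ↔ (a, u) ∈ s := by simp [suitsOf]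

/-- A set of cards is a function from ranks to sets of suits. -/
def suitsEquiv (r : ℕ) : Finset (Card r) ≃ (Fin r → Finset (Fin 4)) where
  toFun := suitsOf
  invFun f := Finset.univ.filter fun c => c.2 ∈ f c.1
  left_inv s := by ext; simp
  right_inv f := by ext; simp

lemma rankCount_eq (s : Finset (Card r)) (a : Fin r) :
    rankCount s a = (suitsOf s a).card := by
  refine Finset.card_nbij' Prod.snd (fun u => (a, u)) ?_ ?_ ?_ ?_
  · rintro ⟨b, u⟩; simp only [Finset.coe_filter, Set.mem_ofPred_eq]
    rintro ⟨h, rfl⟩; simpa using h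
  · intro u; simp
  · rintro ⟨b, u⟩; simp +contextual
  · intro u; simp

lemma card_eq_sum_suitsOf (s : Finset (Card r)) : s.card = ∑ a, (suitsOf s a).card := by
  simp_rw [← rankCount_eq]
  exact Finset.card_eq_sum_card_fiberwise fun _ _ => Finset.mem_coe.2 (Finset.mem_univ _)

/-- The ranks that occur in a hand, given by its suits for each rank. -/
def ranks (f : Fin r → Finset (Fin 4)) : Finset (Fin r) :=
  Finset.univ.filter fun a => (f a).Nonempty

/-- The ranks that occur in the suit `u`. -/
def suitRanks (u : Fin 4) (f : Fin r → Finset (Fin 4)) : Finset (Fin r) :=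
  Finset.univ.filter fun a => u ∈ f a

lemma suitRanks_subset (u : Fin 4) (f : Fin r → Finset (Fin 4)) : suitRanks u f ⊆ ranks f := by
  intro a
  simp only [suitRanks, ranks, Finset.mem_filter, Finset.mem_univ, true_and]
  exact fun h => ⟨u, h⟩

lemma card_suitRanks (u : Fin 4) (s : Finset (Card r)) :
    (suitRanks u (suitsOf s)).card = (s.filter fun c => c.2 = u).card := by
  refine Finset.card_nbij' (fun a => (a, u)) Prod.fst ?_ ?_ ?_ ?_
  · intro a; simp [suitRanks]
  · rintro ⟨b, v⟩; simp only [suitRanks, Finset.coe_filter, Set.mem_ofPred_eq]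
    rintro ⟨h, rfl⟩; simpa using h
  · intro a; simp
  · rintro ⟨b, v⟩; simp +contextual

lemma sum_card_suitRanks (f : Fin r → Finset (Fin 4)) :
    ∑ u, (suitRanks u f).card = ∑ a, (f a).card := by
  simp only [suitRanks, Finset.card_filter]
  rw [Finset.sum_comm]
  simp

/-- A set of ranks that contains five consecutive ones, the ace being both first and last. -/
def IsStraight (S : Finset (Fin r)) : Prop :=
  ∃ k : ℕ, k + 4 ≤ r ∧ ∀ j < 5, ∃ i ∈ S, (i : ℕ) = (k + j) % r

lemma IsStraight.mono {S T : Finset (Fin r)} (h : S ⊆ T) (hS : IsStraight S) : IsStraight T := by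
  obtain ⟨k, hk, H⟩ := hS
  refine ⟨k, hk, fun j hj => ?_⟩
  obtain ⟨i, hi, e⟩ := H j hj
  exact ⟨i, h hi, e⟩

lemma hasStraight_iff (s : Finset (Card r)) : HasStraight s ↔ IsStraight (ranks (suitsOf s)) := by
  unfold HasStraight IsStraight
  refine exists_congr fun k => and_congr_right fun _ => forall₂_congr fun j _ => ?_
  constructor
  · rintro ⟨⟨a, u⟩, h, e⟩
    exact ⟨a, by simpa [ranks] using ⟨u, by simpa using h⟩, e⟩
  · rintro ⟨a, h, e⟩
    obtain ⟨u, hu⟩ := (Finset.mem_filter.1 h).2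
    exact ⟨(a, u), by simpa using hu, e⟩

lemma hasStraight_filter_iff (s : Finset (Card r)) (u : Fin 4) :
    HasStraight (s.filter fun c => c.2 = u) ↔ IsStraight (suitRanks u (suitsOf s)) := by
  rw [hasStraight_iff]
  congr! 1
  ext a
  simp [ranks, suitRanks, Finset.Nonempty]

lemma HasStraight.mono {s t : Finset (Card r)} (h : s ⊆ t) (hs : HasStraight s) :
    HasStraight t := by
  obtain ⟨k, hk, H⟩ := hs
  refine ⟨k, hk, fun j hj => ?_⟩
  obtain ⟨i, hi, e⟩ := H j hj
  exact ⟨i, h hi, e⟩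

/-- Five consecutive ranks are distinct, also across the ace. -/
lemma add_mod_injective (hr : 5 ≤ r) (k : ℕ) :
    Function.Injective fun j : Fin 5 => (k + (j : ℕ)) % r := by
  intro i j h
  have h' : (i : ℕ) ≡ j [MOD r] := Nat.ModEq.add_left_cancel' k h
  rw [Nat.ModEq, Nat.mod_eq_of_lt (by omega), Nat.mod_eq_of_lt (by omega)] at h'
  exact Fin.ext h'

lemma HasStraight.exists_five (hr : 5 ≤ r) {s : Finset (Card r)} (hs : HasStraight s) :
    ∃ t ⊆ s, t.card = 5 ∧ HasStraight t := by
  obtain ⟨k, hk, H⟩ := hs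
  choose c hc e using fun j : Fin 5 => H j j.2
  refine ⟨Finset.univ.image c, by simpa [Finset.image_subset_iff] using hc, ?_, k, hk,
    fun j hj => ⟨c ⟨j, hj⟩, by simp, e ⟨j, hj⟩⟩⟩
  rw [Finset.card_image_of_injective, Finset.card_univ, Fintype.card_fin]
  intro i j h
  exact add_mod_injective hr k (by simp only [← e, h])

lemma IsStraight.five_le_card (hr : 5 ≤ r) {S : Finset (Fin r)} (hS : IsStraight S) :
    5 ≤ S.card := by
  obtain ⟨k, hk, H⟩ := hS
  choose c hc e using fun j : Fin 5 => H j j.2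
  have : (Finset.univ.image c).card = 5 := by
    rw [Finset.card_image_of_injective, Finset.card_univ, Fintype.card_fin]
    intro i j h
    exact add_mod_injective hr k (by simp only [← e, h])
  rw [← this]
  exact Finset.card_le_card (by simpa [Finset.image_subset_iff] using hc)

lemma rankCount_mono {s t : Finset (Card r)} (h : t ⊆ s) (a : Fin r) :
    rankCount t a ≤ rankCount s a :=
  Finset.card_le_card (Finset.filter_subset_filter _ h)

/-- Five cards can be chosen so as to keep `m` cards of one rank and `n` of another. -/
lemma exists_five_rankCount {s : Finset (Card r)} (hs : 5 ≤ s.card) {a b : Fin r} {m n : ℕ}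
    (hmn : m + n ≤ 5) (ha : m ≤ rankCount s a) (hb : n ≤ rankCount s b) :
    ∃ t ⊆ s, t.card = 5 ∧ m ≤ rankCount t a ∧ n ≤ rankCount t b := by
  obtain ⟨A, hA, rfl⟩ := Finset.exists_subset_card_eq ha
  obtain ⟨B, hB, rfl⟩ := Finset.exists_subset_card_eq hb
  obtain ⟨t, ht, hts, ht5⟩ := Finset.exists_subsuperset_card_eq
    (Finset.union_subset (hA.trans (Finset.filter_subset _ _))
      (hB.trans (Finset.filter_subset _ _))) ((Finset.card_union_le A B).trans hmn) hs
  refine ⟨t, hts, ht5, Finset.card_le_card fun c hc => ?_, Finset.card_le_card fun c hc => ?_⟩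
  · exact Finset.mem_filter.2 ⟨ht (Finset.mem_union_left _ hc), (Finset.mem_filter.1 (hA hc)).2⟩
  · exact Finset.mem_filter.2 ⟨ht (Finset.mem_union_right _ hc), (Finset.mem_filter.1 (hB hc)).2⟩

/-- A set of at least five cards contains exactly the types whose pattern it shows as a whole. -/
lemma contains_iff (hr : 5 ≤ r) {s : Finset (Card r)} (hs : 5 ≤ s.card) (h : HandType) :
    Contains s h ↔ match h with
      | .highCard => True
      | .onePair => ∃ a, 2 ≤ rankCount s a
      | .twoPair =>
        (∃ a b, a ≠ b ∧ 2 ≤ rankCount s a ∧ 2 ≤ rankCount s b) ∨ ∃ a, 4 ≤ rankCount s a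
      | .threeOfAKind => ∃ a, 3 ≤ rankCount s a
      | .straight => IsStraight (ranks (suitsOf s))
      | .flush => ∃ u, 5 ≤ (suitRanks u (suitsOf s)).card
      | .fullHouse => ∃ a b, a ≠ b ∧ 3 ≤ rankCount s a ∧ 2 ≤ rankCount s b
      | .fourOfAKind => ∃ a, 4 ≤ rankCount s a
      | .straightFlush => ∃ u, IsStraight (suitRanks u (suitsOf s)) := by
  have one : ∀ (m : ℕ) (_ : m ≤ 5), (∃ t ⊆ s, t.card = 5 ∧ ∃ a, m ≤ rankCount t a) ↔
      ∃ a, m ≤ rankCount s a := by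
    intro m hm
    constructor
    · rintro ⟨t, hts, -, a, ha⟩
      exact ⟨a, ha.trans (rankCount_mono hts a)⟩
    · rintro ⟨a, ha⟩
      obtain ⟨t, hts, h5, h1, -⟩ := exists_five_rankCount hs (n := 0) (b := a) hm ha (Nat.zero_le _)
      exact ⟨t, hts, h5, a, h1⟩
  have two : ∀ (m n : ℕ) (_ : m + n ≤ 5), (∃ t ⊆ s, t.card = 5 ∧
      ∃ a b, a ≠ b ∧ m ≤ rankCount t a ∧ n ≤ rankCount t b) ↔
      ∃ a b, a ≠ b ∧ m ≤ rankCount s a ∧ n ≤ rankCount s b := by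
    intro m n hmn
    constructor
    · rintro ⟨t, hts, -, a, b, hab, ha, hb⟩
      exact ⟨a, b, hab, ha.trans (rankCount_mono hts a), hb.trans (rankCount_mono hts b)⟩
    · rintro ⟨a, b, hab, ha, hb⟩
      obtain ⟨t, hts, h5, h1, h2⟩ := exists_five_rankCount hs hmn ha hb
      exact ⟨t, hts, h5, a, b, hab, h1, h2⟩
  cases h with
  | highCard =>
    obtain ⟨t, hts, h5⟩ := Finset.exists_subset_card_eq hs
    exact iff_of_true ⟨t, hts, h5, trivial⟩ trivial
  | onePair => exact one 2 (by norm_num)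
  | twoPair =>
    simp only [Contains, FiveCard, and_or_left, exists_or]
    exact or_congr (two 2 2 (by norm_num)) (one 4 (by norm_num))
  | threeOfAKind => exact one 3 (by norm_num)
  | straight =>
    simp only [← hasStraight_iff]
    exact ⟨fun ⟨t, hts, _, h⟩ => HasStraight.mono hts h, fun h => h.exists_five hr⟩
  | flush =>
    simp only [card_suitRanks]
    constructor
    · rintro ⟨t, hts, h5, u, hu⟩
      exact ⟨u, h5 ▸ Finset.card_le_card fun c hc => Finset.mem_filter.2 ⟨hts hc, hu c hc⟩⟩
    · rintro ⟨u, hu⟩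
      obtain ⟨t, hts, h5⟩ := Finset.exists_subset_card_eq hu
      exact ⟨t, hts.trans (Finset.filter_subset _ _), h5, u,
        fun c hc => (Finset.mem_filter.1 (hts hc)).2⟩
  | fullHouse => exact two 3 2 (by norm_num)
  | fourOfAKind => exact one 4 (by norm_num)
  | straightFlush =>
    simp only [← hasStraight_filter_iff]
    constructor
    · rintro ⟨t, hts, -, h, u, hu⟩
      exact ⟨u, HasStraight.mono (fun c hc => Finset.mem_filter.2 ⟨hts hc, hu c hc⟩) h⟩
    · rintro ⟨u, h⟩
      obtain ⟨t, hts, h5, ht⟩ := h.exists_five hr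
      exact ⟨t, hts.trans (Finset.filter_subset _ _), h5, ht, u,
        fun c hc => (Finset.mem_filter.1 (hts hc)).2⟩

/-- The data of one rank holding the suits `A`, where `u` is the selected suit. -/
def suitStat (u : Fin 4) (A : Finset (Fin 4)) : Stat := rankStat A.card (if u ∈ A then 1 else 0)

/-- The additive data of a hand consist of the counts that decide which types it contains. -/
lemma sum_suitStat (u : Fin 4) (f : Fin r → Finset (Fin 4)) :
    ∑ a, suitStat u (f a) = (∑ a, (f a).card,
      (Finset.univ.filter fun a => 2 ≤ (f a).card).card,
      (Finset.univ.filter fun a => 3 ≤ (f a).card).card,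
      (Finset.univ.filter fun a => 4 ≤ (f a).card).card, (suitRanks u f).card) := by
  simp [Prod.ext_iff, Prod.fst_sum, Prod.snd_sum, suitStat, rankStat, suitRanks]

open Classical in
/-- The types contained in a hand are determined by its additive data for an arbitrarily selected
suit and by the presence of a straight, a flush and a straight flush. -/
lemma contains_iff_containsType (hr : 5 ≤ r) {s : Finset (Card r)} (hs : 5 ≤ s.card) (u : Fin 4)
    (h : HandType) :
    Contains s h ↔ containsType (∑ a, suitStat u (suitsOf s a))
      (decide (IsStraight (ranks (suitsOf s))))
      (decide (∃ u, 5 ≤ (suitRanks u (suitsOf s)).card))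
      (decide (∃ u, IsStraight (suitRanks u (suitsOf s)))) h = true := by
  have one : ∀ m, 1 ≤ (Finset.univ.filter fun a => m ≤ (suitsOf s a).card).card ↔
      ∃ a, m ≤ (suitsOf s a).card := by
    intro m
    simp [Nat.one_le_iff_ne_zero, Finset.filter_eq_empty_iff]
  have two : ∀ {a}, 2 ≤ (Finset.univ.filter fun a => 2 ≤ (suitsOf s a).card).card →
      ∃ b, b ≠ a ∧ 2 ≤ (suitsOf s b).card := by
    intro a h
    obtain ⟨b, hb, hba⟩ := Finset.exists_mem_ne (Nat.lt_of_succ_le h) a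
    exact ⟨b, hba, (Finset.mem_filter.1 hb).2⟩
  rw [contains_iff hr hs, sum_suitStat]
  cases h <;> simp only [containsType, rankCount_eq, decide_eq_true_eq, Bool.or_eq_true,
    Bool.and_eq_true, one]
  · refine or_congr_left ⟨?_, ?_⟩
    · rintro ⟨a, b, hab, ha, hb⟩
      exact Finset.one_lt_card.2 ⟨a, by simpa using ha, b, by simpa using hb, hab⟩
    · intro h
      obtain ⟨a, ha, b, hb, hab⟩ := Finset.one_lt_card.1 h
      exact ⟨a, b, hab, (Finset.mem_filter.1 ha).2, (Finset.mem_filter.1 hb).2⟩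
  · constructor
    · rintro ⟨a, b, hab, ha, hb⟩
      exact ⟨⟨a, ha⟩, Finset.one_lt_card.2 ⟨a, by simp; omega, b, by simpa using hb, hab⟩⟩
    · rintro ⟨⟨a, ha⟩, h⟩
      obtain ⟨b, hba, hb⟩ := two (a := a) h
      exact ⟨a, b, hba.symm, ha, hb⟩

/-! ### Counting hands -/

open Classical in
/-- The number of sets of `k` ranks that contain five consecutive ones. -/
noncomputable def straightSets (r k : ℕ) : ℕ :=
  (((Finset.univ : Finset (Fin r)).powersetCard k).filter IsStraight).card

open Classical in
/-- Sum over all sets of ranks of a quantity that depends on the size of the set and on whether it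
contains five consecutive ranks. -/
lemma sum_rankSets (r N : ℕ) (X Y : ℕ → ℤ) (hX : ∀ k, N ≤ k → X k = 0)
    (hY : ∀ k, N ≤ k → Y k = 0) :
    ∑ S : Finset (Fin r), (if IsStraight S then X S.card else Y S.card) =
      ∑ k ∈ Finset.range N,
        (straightSets r k * X k + ((r.choose k : ℤ) - straightSets r k) * Y k) := by
  have h1 : ∀ k, ∑ S ∈ (Finset.univ : Finset (Fin r)).powersetCard k,
      (if IsStraight S then X S.card else Y S.card) =
        straightSets r k * X k + ((r.choose k : ℤ) - straightSets r k) * Y k := by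
    intro k
    have hc := Finset.card_filter_add_card_filter_not
      (s := (Finset.univ : Finset (Fin r)).powersetCard k) IsStraight
    rw [Finset.card_powersetCard, Finset.card_univ, Fintype.card_fin] at hc
    rw [← hc, Finset.sum_congr rfl (g := fun S => if IsStraight S then X k else Y k)
      (fun S hS => by rw [(Finset.mem_powersetCard.1 hS).2]), Finset.sum_ite, Finset.sum_const,
      Finset.sum_const, nsmul_eq_mul, nsmul_eq_mul, straightSets]
    push_cast
    ring
  -- Both ranges of summation are extended to a common one, on which the new terms vanish.
  rw [← Finset.powerset_univ, Finset.sum_powerset, Finset.card_univ, Fintype.card_fin,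
    Finset.sum_congr rfl fun k _ => h1 k,
    ← Finset.eventually_constant_sum (N := r + 1) (n := r + 1 + N) _ (by omega),
    ← Finset.eventually_constant_sum (N := N) (n := r + 1 + N) _ (by omega)]
  · intro k hk
    rw [hX k hk, hY k hk]; ring
  · intro k hk
    rw [← h1, Finset.powersetCard_eq_empty.2 (by simpa using hk), Finset.sum_empty]

lemma light_of_add (a v : Stat) (h : AtMostSeven (a + v) = true) : AtMostSeven v = true := by
  simp only [AtMostSeven, Prod.fst_add, decide_eq_true_eq] at h ⊢
  omega

lemma map_suitStat_noSuit (u : Fin 4) : ({∅} : Finset (Finset (Fin 4))).val.map (suitStat u) =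
    ((noSuit.flatMap fun p => List.replicate p.1 p.2 : List Stat) : Multiset Stat) := by
  simp [noSuit, suitStat]

lemma map_suitStat_nonempty : ∀ u : Fin 4,
    (Finset.univ.filter fun A : Finset (Fin 4) => A.Nonempty).val.map (suitStat u) =
      (((withSuit ++ offSuit).flatMap fun p => List.replicate p.1 p.2 : List Stat) :
        Multiset Stat) := by
  decide +kernel

lemma map_suitStat_mem : ∀ u : Fin 4,
    (Finset.univ.filter fun A : Finset (Fin 4) => u ∈ A).val.map (suitStat u) =
      ((withSuit.flatMap fun p => List.replicate p.1 p.2 : List Stat) : Multiset Stat) := by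
  decide +kernel

lemma map_suitStat_notMem : ∀ u : Fin 4,
    (Finset.univ.filter fun A : Finset (Fin 4) => u ∉ A).val.map (suitStat u) =
      (((noSuit ++ offSuit).flatMap fun p => List.replicate p.1 p.2 : List Stat) :
        Multiset Stat) := by
  decide +kernel

/-- Eight ranks need eight cards. -/
lemma bySupport_eq_nil {k : ℕ} (hk : 8 ≤ k) : bySupport k = [] :=
  truncPow_eq_nil (m := 8) (by decide +kernel) _ hk 0

lemma bySuitRanks_eq_nil {k : ℕ} (hk : 8 ≤ k) (n : ℕ) : bySuitRanks k n = [] :=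
  truncPow_eq_nil (m := 8) (by decide +kernel) _ hk n

/-- The hands in which exactly the ranks in `S` occur are the functions with nonempty values on `S`
and empty values elsewhere. -/
lemma sum_ranks_eq (u : Fin 4) (S : Finset (Fin r)) (F : Stat → ℤ)
    (hF : ∀ v, AtMostSeven v = false → F v = 0) :
    ∑ f with ranks f = S, F (∑ a, suitStat u (f a)) = evalAt F (bySupport S.card) := by
  have h : (Finset.univ.filter fun f : Fin r → Finset (Fin 4) => ranks f = S) =
      Fintype.piFinset (fun a => if a ∈ S then Finset.univ.filter fun A => A.Nonempty else {∅}) := by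
    ext f
    simp only [Finset.mem_filter, Finset.mem_univ, true_and, Fintype.mem_piFinset, ranks,
      Finset.ext_iff (s₂ := S)]
    refine forall_congr' fun a => ?_
    by_cases ha : a ∈ S <;> simp [ha]
  have h1 : toAlg noSuit = 1 := by simp [toAlg, noSuit, AddMonoidAlgebra.one_def, rankStat]; rfl
  rw [h, sum_piFinset_eq_functional (suitStat u) _ _ _ _ (map_suitStat_nonempty u)
    (map_suitStat_noSuit u), h1, one_pow, ← pow_zero (toAlg noSuit),
    truncEq_truncPow light_of_add _ _ _ _ F hF, functional_toAlg, bySupport]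

/-- The hands whose ranks in the suit `u` form the set `S` are the functions whose values contain
`u` exactly on `S`. -/
lemma sum_suitRanks_eq (u : Fin 4) (S : Finset (Fin r)) (F : Stat → ℤ)
    (hF : ∀ v, AtMostSeven v = false → F v = 0) :
    ∑ f with suitRanks u f = S, F (∑ a, suitStat u (f a)) =
      evalAt F (bySuitRanks S.card (r - S.card)) := by
  have h : (Finset.univ.filter fun f : Fin r → Finset (Fin 4) => suitRanks u f = S) =
      Fintype.piFinset (fun a => if a ∈ S then Finset.univ.filter fun A => u ∈ A
        else Finset.univ.filter fun A => u ∉ A) := by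
    ext f
    simp only [Finset.mem_filter, Finset.mem_univ, true_and, Fintype.mem_piFinset, suitRanks,
      Finset.ext_iff (s₂ := S)]
    refine forall_congr' fun a => ?_
    by_cases ha : a ∈ S <;> simp [ha]
  rw [h, sum_piFinset_eq_functional (suitStat u) _ _ _ _ (map_suitStat_mem u)
    (map_suitStat_notMem u), truncEq_truncPow light_of_add _ _ _ _ F hF, functional_toAlg,
    Fintype.card_fin, bySuitRanks]

open Classical in
lemma sum_isStraight_ranks (u : Fin 4) (G : Bool → Stat → ℤ)
    (hG : ∀ b v, AtMostSeven v = false → G b v = 0) :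
    ∑ f : Fin r → Finset (Fin 4), G (decide (IsStraight (ranks f))) (∑ a, suitStat u (f a)) =
      ∑ k ∈ Finset.range 8, (straightSets r k * evalAt (G true) (bySupport k) +
        ((r.choose k : ℤ) - straightSets r k) * evalAt (G false) (bySupport k)) := by
  rw [← sum_rankSets r 8 (fun k => evalAt (G true) (bySupport k))
    (fun k => evalAt (G false) (bySupport k)) (fun k hk => by simp [bySupport_eq_nil hk, evalAt])
    (fun k hk => by simp [bySupport_eq_nil hk, evalAt]), ← Finset.sum_fiberwise _ ranks]
  refine Finset.sum_congr rfl fun S _ => ?_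
  rw [Finset.sum_congr rfl (g := fun f => G (decide (IsStraight S)) (∑ a, suitStat u (f a)))
    (fun f hf => by rw [(Finset.mem_filter.1 hf).2]), sum_ranks_eq u S _ (hG _)]
  by_cases h : IsStraight S <;> simp [h]

open Classical in
lemma sum_isStraight_suitRanks (u : Fin 4) (F : Stat → ℤ)
    (hF : ∀ v, AtMostSeven v = false → F v = 0) :
    ∑ f : Fin r → Finset (Fin 4),
        (if IsStraight (suitRanks u f) then F (∑ a, suitStat u (f a)) else 0) =
      ∑ k ∈ Finset.range 8, straightSets r k * evalAt F (bySuitRanks k (r - k)) := by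
  have := sum_rankSets r 8 (fun k => evalAt F (bySuitRanks k (r - k))) (fun _ => 0)
    (fun k hk => by simp [bySuitRanks_eq_nil hk, evalAt]) (fun _ _ => rfl)
  simp only [mul_zero, add_zero] at this
  rw [← this, ← Finset.sum_fiberwise _ (suitRanks u)]
  refine Finset.sum_congr rfl fun S _ => ?_
  rw [Finset.sum_congr rfl (g := fun f =>
    if IsStraight S then F (∑ a, suitStat u (f a)) else 0)
    (fun f hf => by rw [(Finset.mem_filter.1 hf).2])]
  by_cases h : IsStraight S
  · simp only [h, if_true]; exact sum_suitRanks_eq u S F hF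
  · simp [h]

lemma indicator_eq_zero (h : HandType) (ex : List HandType) {v : Stat} (hv : v.1 ≠ 7)
    (st fl sf : Bool) : indicator h ex v st fl sf = 0 := by
  simp [indicator, hv]

/-- Without its last entry, the data do not depend on the selected suit. -/
lemma indicator_suitStat (h : HandType) (ex : List HandType) (u u' : Fin 4)
    (f : Fin r → Finset (Fin 4)) (st fl sf : Bool) :
    indicator h ex (∑ a, suitStat u (f a)) st fl sf =
      indicator h ex (∑ a, suitStat u' (f a)) st fl sf := by
  have : ∀ h', containsType (∑ a, suitStat u (f a)) st fl sf h' =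
      containsType (∑ a, suitStat u' (f a)) st fl sf h' := by
    intro h'
    rw [sum_suitStat, sum_suitStat]
    cases h' <;> rfl
  simp only [indicator, this]
  simp only [sum_suitStat]

open Classical in
/-- Seven cards contain a flush in at most one suit, so flushes and straight flushes can be
accounted for suit by suit. -/
lemma indicator_eq_add_sum (hr : 5 ≤ r) (h : HandType) (ex : List HandType)
    (f : Fin r → Finset (Fin 4)) :
    indicator h ex (∑ a, suitStat 0 (f a)) (decide (IsStraight (ranks f)))
        (decide (∃ u, 5 ≤ (suitRanks u f).card)) (decide (∃ u, IsStraight (suitRanks u f))) =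
      indicator h ex (∑ a, suitStat 0 (f a)) (decide (IsStraight (ranks f))) false false +
      ∑ u, flushCorrection h ex (decide (IsStraight (ranks f))) (∑ a, suitStat u (f a)) +
      ∑ u, (if IsStraight (suitRanks u f) then
        straightFlushCorrection h ex (∑ a, suitStat u (f a)) else 0) := by
  have hfc : ∀ u, flushCorrection h ex (decide (IsStraight (ranks f))) (∑ a, suitStat u (f a)) =
      if 5 ≤ (suitRanks u f).card then
        indicator h ex (∑ a, suitStat 0 (f a)) (decide (IsStraight (ranks f))) true false -
        indicator h ex (∑ a, suitStat 0 (f a)) (decide (IsStraight (ranks f))) false false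
      else 0 := by
    intro u
    simp only [flushCorrection, indicator_suitStat h ex u 0]
    rw [sum_suitStat u]
  have hsc : ∀ u, straightFlushCorrection h ex (∑ a, suitStat u (f a)) =
      straightFlushCorrection h ex (∑ a, suitStat 0 (f a)) := by
    intro u
    simp only [straightFlushCorrection, indicator_suitStat h ex u 0]
  simp only [hfc, hsc]
  by_cases h7 : (∑ a, suitStat 0 (f a)).1 = 7
  swap
  · simp [straightFlushCorrection, indicator_eq_zero h ex h7]
  rw [sum_suitStat, ← sum_card_suitRanks] at h7
  by_cases hfl : ∃ u, 5 ≤ (suitRanks u f).card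
  · obtain ⟨u, hu⟩ := hfl
    have huniq : ∀ u', u' ≠ u → ¬ 5 ≤ (suitRanks u' f).card := by
      intro u' hne h5
      have := Finset.add_le_sum (f := fun u => (suitRanks u f).card)
        (fun _ _ => Nat.zero_le _) (Finset.mem_univ u) (Finset.mem_univ u') hne.symm
      simp only at this h7
      omega
    rw [Finset.sum_eq_single u (fun u' _ hne => if_neg (huniq u' hne)) (by simp),
      Finset.sum_eq_single u (fun u' _ hne => if_neg fun hs => huniq u' hne (hs.five_le_card hr))
        (by simp), if_pos hu]
    have hex : (∃ u', IsStraight (suitRanks u' f)) ↔ IsStraight (suitRanks u f) := by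
      refine ⟨fun ⟨u', h'⟩ => ?_, fun h' => ⟨u, h'⟩⟩
      by_cases e : u' = u
      · exact e ▸ h'
      · exact absurd (h'.five_le_card hr) (huniq u' e)
    simp only [hex, decide_eq_true (⟨u, hu⟩ : ∃ u, 5 ≤ (suitRanks u f).card)]
    by_cases hs : IsStraight (suitRanks u f)
    · simp [hs, hs.mono (suitRanks_subset u f), straightFlushCorrection]
    · simp [hs]
  · have hsf : ¬ ∃ u, IsStraight (suitRanks u f) := fun ⟨u, hu⟩ => hfl ⟨u, hu.five_le_card hr⟩
    have h1 : ∀ u, ¬ 5 ≤ (suitRanks u f).card := fun u hu => hfl ⟨u, hu⟩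
    have h2 : ∀ u, ¬ IsStraight (suitRanks u f) := fun u hu => hsf ⟨u, hu⟩
    simp [h1, h2]

open Classical in
/-- The number of seven-card hands that contain `h` and avoid the types in `ex`. -/
theorem card_filter_eq_handCount (hr : 5 ≤ r) (h : HandType) (ex : List HandType) :
    (((hands r).filter fun s => Contains s h ∧ ∀ h' ∈ ex, ¬ Contains s h').card : ℤ) =
      handCount (straightSets r) r h ex := by
  have hlight : ∀ v, AtMostSeven v = false → v.1 ≠ 7 := by
    intro v hv h7
    simp [AtMostSeven, h7] at hv
  have hcard : (((hands r).filter fun s => Contains s h ∧ ∀ h' ∈ ex, ¬ Contains s h').card : ℤ) =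
      ∑ f : Fin r → Finset (Fin 4), indicator h ex (∑ a, suitStat 0 (f a))
        (decide (IsStraight (ranks f))) (decide (∃ u, 5 ≤ (suitRanks u f).card))
        (decide (∃ u, IsStraight (suitRanks u f))) := by
    rw [hands, Finset.powersetCard_eq_filter, Finset.filter_filter, Finset.powerset_univ,
      Finset.card_filter, Nat.cast_sum, ← Equiv.sum_comp (suitsEquiv r)]
    refine Finset.sum_congr rfl fun s _ => ?_
    have e : (∑ a, suitStat 0 (suitsOf s a)).1 = s.card := by
      rw [sum_suitStat, card_eq_sum_suitsOf]
    rw [Nat.cast_ite, Nat.cast_one, Nat.cast_zero, indicator]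
    refine if_congr ?_ rfl rfl
    change _ ↔ (∑ a, suitStat 0 (suitsOf s a)).1 = 7 ∧ _
    rw [e]
    refine and_congr_right fun h7 => ?_
    have hc := contains_iff_containsType hr (s := s) (by omega) 0
    refine and_congr (hc h) (forall₂_congr fun h' _ => ?_)
    rw [hc h', Bool.not_eq_true]
    rfl
  -- By symmetry the four suits contribute equally.
  have hflush : ∀ u, ∑ f : Fin r → Finset (Fin 4),
      flushCorrection h ex (decide (IsStraight (ranks f))) (∑ a, suitStat u (f a)) =
      ∑ f : Fin r → Finset (Fin 4),
      flushCorrection h ex (decide (IsStraight (ranks f))) (∑ a, suitStat 0 (f a)) := by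
    intro u
    have hz : ∀ b v, AtMostSeven v = false → flushCorrection h ex b v = 0 := fun b v hv => by
      simp [flushCorrection, indicator_eq_zero h ex (hlight v hv)]
    rw [sum_isStraight_ranks u _ hz, sum_isStraight_ranks 0 _ hz]
  rw [hcard, Finset.sum_congr rfl fun f _ => indicator_eq_add_sum hr h ex f,
    Finset.sum_add_distrib, Finset.sum_add_distrib, Finset.sum_comm,
    Finset.sum_comm (f := fun f u => if IsStraight (suitRanks u f) then _ else _)]
  rw [Finset.sum_congr rfl fun u _ => hflush u, Finset.sum_congr rfl fun u _ =>
    sum_isStraight_suitRanks u (straightFlushCorrection h ex) fun v hv => by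
      simp [straightFlushCorrection, indicator_eq_zero h ex (hlight v hv)]]
  simp only [Finset.sum_const, Finset.card_univ, Fintype.card_fin, nsmul_eq_mul]
  rw [Finset.mul_sum, ← Finset.sum_add_distrib]
  have := sum_isStraight_ranks (r := r) 0
    (fun st v => indicator h ex v st false false + 4 * flushCorrection h ex st v) fun b v hv => by
      simp [flushCorrection, indicator_eq_zero h ex (hlight v hv)]
  push_cast
  rw [this, handCount, Finset.mul_sum, ← Finset.sum_add_distrib]
  refine Finset.sum_congr rfl fun k _ => ?_
  congr 1
  split_ifs with h0
  · simp [h0]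
  · rfl

end Hands

/-! ### Sets of ranks with five consecutive members -/

/-- Among the numbers `m ||| ∑ i ∈ S, 2 ^ i`, where `S` runs over the `k`-element subsets of
`{0, …, n - 1}`, the number of those that satisfy `p`. -/
def countMasks (p : ℕ → Bool) : ℕ → ℕ → ℕ → ℕ
  | 0, 0, m => if p m then 1 else 0
  | 0, _ + 1, _ => 0
  | n + 1, 0, m => countMasks p n 0 m
  | n + 1, k + 1, m => countMasks p n (k + 1) m + countMasks p n k (m ||| 2 ^ n)

/-- The binary digits of `m` are the elements of `T`. -/
def IsMask (m : ℕ) (T : Finset ℕ) : Prop := ∀ i, m.testBit i = true ↔ i ∈ T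

lemma IsMask.insert {m : ℕ} {T : Finset ℕ} (h : IsMask m T) (n : ℕ) :
    IsMask (m ||| 2 ^ n) (insert n T) := by
  intro i
  rw [Nat.testBit_or, Bool.or_eq_true, h i, Nat.testBit_two_pow, decide_eq_true_eq,
    Finset.mem_insert, or_comm, eq_comm]

open Classical in
/-- `countMasks` decides for the largest number first and collects those already chosen in `m`,
whose digits form the set `T`. -/
lemma countMasks_eq {p : ℕ → Bool} {P : Finset ℕ → Prop} {r : ℕ}
    (hp : ∀ m T, T ⊆ Finset.range r → IsMask m T → (p m = true ↔ P T)) (n k m : ℕ) (T : Finset ℕ)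
    (hn : n ≤ r) (hT : T ⊆ Finset.range r) (hm : IsMask m T) :
    countMasks p n k m =
      (((Finset.range n).powersetCard k).filter fun S => P (S ∪ T)).card := by
  induction n generalizing k m T with
  | zero =>
    cases k with
    | zero =>
      rw [countMasks, Finset.powersetCard_zero, Finset.filter_singleton, Finset.empty_union]
      simp only [hp m T hT hm]
      split_ifs <;> simp
    | succ k =>
      rw [countMasks, Finset.powersetCard_eq_empty.2 (by simp), Finset.filter_empty,
        Finset.card_empty]
  | succ n ih =>
    cases k with
    | zero => rw [countMasks, ih 0 m T (by omega) hT hm, Finset.powersetCard_zero,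
        Finset.powersetCard_zero]
    | succ k =>
      have hnT : insert n T ⊆ Finset.range r :=
        Finset.insert_subset (Finset.mem_range.2 hn) hT
      have hmem : ∀ j, ∀ S ∈ (Finset.range n).powersetCard j, n ∉ S := fun j S hS h => by
        simpa using (Finset.mem_powersetCard.1 hS).1 h
      rw [countMasks, ih (k + 1) m T (by omega) hT hm,
        ih k _ (insert n T) (by omega) hnT (hm.insert n), Finset.range_add_one,
        Finset.powersetCard_succ_insert (by simp), Finset.filter_union,
        Finset.card_union_of_disjoint, Finset.filter_image, Finset.card_image_of_injOn]
      · simp only [Finset.insert_union, Finset.union_insert]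
      · intro S hS S' hS' e
        have h1 := hmem k S (Finset.mem_filter.1 hS).1
        have h2 := hmem k S' (Finset.mem_filter.1 hS').1
        rw [← Finset.erase_insert h1, ← Finset.erase_insert h2, e]
      · refine Finset.disjoint_left.2 fun S hS hS' => ?_
        obtain ⟨S₀, -, rfl⟩ := Finset.mem_image.1 (Finset.mem_filter.1 hS').1
        exact hmem _ _ (Finset.mem_filter.1 hS).1 (Finset.mem_insert_self _ _)

/-- Whether the set of binary digits of `m`, enlarged by `r` if it contains `0`, contains five
consecutive numbers. -/
def maskStraight (r m : ℕ) : Bool :=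
  let a := if m.testBit 0 then m ||| 2 ^ r else m
  (a &&& a >>> 1 &&& a >>> 2 &&& a >>> 3 &&& a >>> 4) != 0

lemma maskStraight_iff {r : ℕ} (hr : 0 < r) (m : ℕ) (T : Finset ℕ) (hT : T ⊆ Finset.range r)
    (hm : IsMask m T) :
    maskStraight r m = true ↔ ∃ k, k + 4 ≤ r ∧ ∀ j < 5, (k + j) % r ∈ T := by
  set a := if m.testBit 0 then m ||| 2 ^ r else m with ha
  -- The digits of `a` are the positions in the list of ranks that ends with a second ace.
  have hbit : ∀ i, a.testBit i = true ↔ i ≤ r ∧ i % r ∈ T := by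
    intro i
    have hlt : ∀ {i}, i ∈ T → i < r := fun h => Finset.mem_range.1 (hT h)
    have hb : a.testBit i = true ↔ i ∈ T ∨ (i = r ∧ 0 ∈ T) := by
      by_cases h0 : 0 ∈ T
      · rw [ha, if_pos ((hm 0).2 h0), (hm.insert r) i, Finset.mem_insert]
        tauto
      · rw [ha, if_neg (fun h => h0 ((hm 0).1 h)), hm i]
        tauto
    rw [hb]
    constructor
    · rintro (h | ⟨rfl, h⟩)
      · exact ⟨(hlt h).le, by rwa [Nat.mod_eq_of_lt (hlt h)]⟩
      · exact ⟨le_rfl, by rwa [Nat.mod_self]⟩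
    · rintro ⟨h, h'⟩
      rcases h.lt_or_eq with h | rfl
      · rw [Nat.mod_eq_of_lt h] at h'; exact Or.inl h'
      · rw [Nat.mod_self] at h'; exact Or.inr ⟨rfl, h'⟩
  have hand : ∀ k, (a &&& a >>> 1 &&& a >>> 2 &&& a >>> 3 &&& a >>> 4).testBit k = true ↔
      ∀ j < 5, a.testBit (k + j) = true := by
    intro k
    simp only [Nat.testBit_and, Nat.testBit_shiftRight, Bool.and_eq_true]
    constructor
    · intro h j hj
      interval_cases j <;> simp_all [add_comm]
    · intro h
      have := fun j hj => (add_comm k j) ▸ h j hj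
      exact ⟨⟨⟨⟨h 0 (by norm_num), this 1 (by norm_num)⟩, this 2 (by norm_num)⟩,
        this 3 (by norm_num)⟩, this 4 (by norm_num)⟩
  have hne : maskStraight r m = true ↔
      (a &&& a >>> 1 &&& a >>> 2 &&& a >>> 3 &&& a >>> 4) ≠ 0 := by
    simp only [maskStraight, bne_iff_ne]
    rfl
  rw [hne]
  constructor
  · intro h
    obtain ⟨k, hk⟩ := Nat.exists_testBit_of_ne_zero h
    have := fun j hj => (hbit _).1 ((hand k).1 hk j hj)
    exact ⟨k, (this 4 (by norm_num)).1, fun j hj => (this j hj).2⟩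
  · rintro ⟨k, hk, H⟩ h0
    have := (hand k).2 fun j hj => (hbit _).2 ⟨by omega, H j hj⟩
    rw [h0] at this
    simp at this

lemma straightSets_eq_countMasks {r : ℕ} (hr : 0 < r) (k : ℕ) :
    straightSets r k = countMasks (maskStraight r) r k 0 := by
  classical
  rw [countMasks_eq (maskStraight_iff hr) r k 0 ∅ le_rfl (by simp) (by intro i; simp),
    straightSets]
  refine Finset.card_bij (fun S _ => S.map Fin.valEmbedding) ?_ ?_ ?_
  · intro S hS
    simp only [Finset.mem_filter, Finset.mem_powersetCard] at hS ⊢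
    refine ⟨⟨fun i hi => ?_, by simpa using hS.1.2⟩, ?_⟩
    · obtain ⟨j, -, rfl⟩ := Finset.mem_map.1 hi
      exact Finset.mem_range.2 j.2
    · obtain ⟨k, hk, H⟩ := hS.2
      refine ⟨k, hk, fun j hj => ?_⟩
      obtain ⟨i, hi, e⟩ := H j hj
      rw [← e, Finset.union_empty]
      exact Finset.mem_map_of_mem Fin.valEmbedding hi
  · intro S _ S' _ e
    exact Finset.map_injective _ e
  · intro T hT
    simp only [Finset.mem_filter, Finset.mem_powersetCard, Finset.union_empty] at hT
    have hmap : (T.attachFin fun i hi => Finset.mem_range.1 (hT.1.1 hi)).map Fin.valEmbedding =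
        T := Finset.map_valEmbedding_attachFin _
    refine ⟨T.attachFin fun i hi => Finset.mem_range.1 (hT.1.1 hi), ?_, hmap⟩
    simp only [Finset.mem_filter, Finset.mem_powersetCard, Finset.subset_univ, true_and,
      Finset.card_attachFin]
    refine ⟨hT.1.2, ?_⟩
    obtain ⟨k, hk, H⟩ := hT.2
    exact ⟨k, hk, fun j hj => ⟨⟨_, Nat.mod_lt _ hr⟩, by simpa using H j hj, rfl⟩⟩

/-! ### Frequencies and showdown frequencies -/

/-- All hand types. -/
def handTypes : List HandType :=
  [.highCard, .onePair, .twoPair, .threeOfAKind, .straight, .flush, .fullHouse, .fourOfAKind,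
    .straightFlush]

lemma mem_handTypes (h : HandType) : h ∈ handTypes := by cases h <;> simp [handTypes]

/-- The function on hand types with the given values, in the order in which the types are
declared. -/
def table (hc p pp t st fl fh q sf : ℕ) : HandType → ℕ
  | .highCard => hc
  | .onePair => p
  | .twoPair => pp
  | .threeOfAKind => t
  | .straight => st
  | .flush => fl
  | .fullHouse => fh
  | .fourOfAKind => q
  | .straightFlush => sf

/-- The sequence with values `a`, `b`, `c` at `5`, `6`, `7`, and `0` elsewhere. -/
def fiveSixSeven (a b c : ℕ) : ℕ → ℕ
  | 5 => a
  | 6 => b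
  | 7 => c
  | _ => 0

lemma handCount_congr {A B : ℕ → ℕ} (h : ∀ k < 8, A k = B k) (r : ℕ) (t : HandType)
    (ex : List HandType) : handCount A r t ex = handCount B r t ex :=
  Finset.sum_congr rfl fun k hk => by rw [h k (Finset.mem_range.1 hk)]

theorem freq_eq_of_handCount {r : ℕ} (hr : 5 ≤ r) {A : ℕ → ℕ}
    (hA : ∀ k < 8, countMasks (maskStraight r) r k 0 = A k) {F : HandType → ℕ}
    (hF : ∀ h ∈ handTypes, handCount A r h [] = F h) (h : HandType) : freq r h = F h := by
  have e := card_filter_eq_handCount hr h []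
  rw [handCount_congr (B := A) (fun k hk => by rw [straightSets_eq_countMasks (by omega), hA k hk]),
    hF h (mem_handTypes h), Nat.cast_inj] at e
  rw [← e, freq]
  congr 1
  ext s
  simp

theorem showdownFreq_eq_handCount {r : ℕ} (hr : 5 ≤ r) {A : ℕ → ℕ}
    (hA : ∀ k < 8, countMasks (maskStraight r) r k 0 = A k) {F : HandType → ℕ}
    (hF : ∀ h, freq r h = F h) (h : HandType) :
    (showdownFreq r (freqRanking r) h : ℤ) =
      handCount A r h (handTypes.filter fun h' => F h' < F h) := by
  have e := card_filter_eq_handCount hr h (handTypes.filter fun h' => F h' < F h)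
  rw [handCount_congr (B := A) fun k hk => by
    rw [straightSets_eq_countMasks (by omega), hA k hk]] at e
  rw [← e, Nat.cast_inj, showdownFreq]
  congr 1
  ext s
  simp only [Finset.mem_filter]
  simp [freqRanking, hF, mem_handTypes]

theorem showdownFreq_eq_of_handCount {r : ℕ} (hr : 5 ≤ r) {A : ℕ → ℕ}
    (hA : ∀ k < 8, countMasks (maskStraight r) r k 0 = A k) {F G : HandType → ℕ}
    (hF : ∀ h, freq r h = F h)
    (hG : ∀ h ∈ handTypes, handCount A r h (handTypes.filter fun h' => F h' < F h) = G h)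
    (h : HandType) : showdownFreq r (freqRanking r) h = G h := by
  have e := showdownFreq_eq_handCount hr hA hF h
  rw [hG h (mem_handTypes h)] at e
  exact_mod_cast e

lemma showdownFreq_lt {r : ℕ} (hr : 5 ≤ r) {A : ℕ → ℕ}
    (hA : ∀ k < 8, countMasks (maskStraight r) r k 0 = A k) {F : HandType → ℕ}
    (hF : ∀ h, freq r h = F h) {h₀ h₁ : HandType}
    (hlt : handCount A r h₀ (handTypes.filter fun h' => F h' < F h₀) <
      handCount A r h₁ (handTypes.filter fun h' => F h' < F h₁)) :
    showdownFreq r (freqRanking r) h₀ < showdownFreq r (freqRanking r) h₁ := by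
  rw [← showdownFreq_eq_handCount hr hA hF, ← showdownFreq_eq_handCount hr hA hF] at hlt
  exact_mod_cast hlt

/-- The rankings disagree once a more frequent type is shown down less often. -/
lemma not_agreeExceptHighCard {r : ℕ} {h₀ h₁ : HandType} (hh₀ : h₀ ≠ .highCard)
    (hh₁ : h₁ ≠ .highCard) (hf : freq r h₁ < freq r h₀)
    (hs : showdownFreq r (freqRanking r) h₀ < showdownFreq r (freqRanking r) h₁) :
    ¬ AgreeExceptHighCard (showdownRanking r (freqRanking r)) (freqRanking r) :=
  fun H => hf.asymm ((H h₀ h₁ hh₀ hh₁).1 hs)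

/-! ### Values for five to thirteen ranks -/

lemma countMasks_5 :
    ∀ k < 8, countMasks (maskStraight 5) 5 k 0 = fiveSixSeven 1 0 0 k := by
  decide +kernel

lemma freq_5 : ∀ h, freq 5 h =
    table 77520 77520 72400 37200 28160 420 30800 2800 420 h :=
  freq_eq_of_handCount (by norm_num) countMasks_5 (by decide +kernel)

lemma not_agreeExceptHighCard_5 :
    ¬ AgreeExceptHighCard (showdownRanking 5 (freqRanking 5)) (freqRanking 5) :=
  not_agreeExceptHighCard (h₀ := .onePair) (h₁ := .twoPair) (by decide) (by decide)
    (by simp only [freq_5, table]; norm_num)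
    (showdownFreq_lt (by norm_num) countMasks_5 freq_5 (by decide +kernel))

lemma countMasks_6 :
    ∀ k < 8, countMasks (maskStraight 6) 6 k 0 = fiveSixSeven 3 1 0 k := by
  decide +kernel

lemma freq_6 : ∀ h, freq 6 h =
    table 346104 346104 278520 119160 121344 3744 84600 6840 1908 h :=
  freq_eq_of_handCount (by norm_num) countMasks_6 (by decide +kernel)

lemma not_agreeExceptHighCard_6 :
    ¬ AgreeExceptHighCard (showdownRanking 6 (freqRanking 6)) (freqRanking 6) :=
  not_agreeExceptHighCard (h₀ := .onePair) (h₁ := .twoPair) (by decide) (by decide)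
    (by simp only [freq_6, table]; norm_num)
    (showdownFreq_lt (by norm_num) countMasks_6 freq_6 (by decide +kernel))

lemma countMasks_7 :
    ∀ k < 8, countMasks (maskStraight 7) 7 k 0 = fiveSixSeven 4 5 1 k := by
  decide +kernel

lemma freq_7 : ∀ h, freq 7 h =
    table 1184040 1167656 802088 304808 313344 18232 188328 14168 3784 h :=
  freq_eq_of_handCount (by norm_num) countMasks_7 (by decide +kernel)

lemma not_agreeExceptHighCard_7 :
    ¬ AgreeExceptHighCard (showdownRanking 7 (freqRanking 7)) (freqRanking 7) :=
  not_agreeExceptHighCard (h₀ := .onePair) (h₁ := .twoPair) (by decide) (by decide)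
    (by simp only [freq_7, table]; norm_num)
    (showdownFreq_lt (by norm_num) countMasks_7 freq_7 (by decide +kernel))

lemma countMasks_8 :
    ∀ k < 8, countMasks (maskStraight 8) 8 k 0 = fiveSixSeven 5 11 7 k := by
  decide +kernel

lemma freq_8 : ∀ h, freq 8 h =
    table 3365856 3234784 1915872 670432 660992 64544 365792 26208 6604 h :=
  freq_eq_of_handCount (by norm_num) countMasks_8 (by decide +kernel)

lemma not_agreeExceptHighCard_8 :
    ¬ AgreeExceptHighCard (showdownRanking 8 (freqRanking 8)) (freqRanking 8) :=
  not_agreeExceptHighCard (h₀ := .onePair) (h₁ := .twoPair) (by decide) (by decide)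
    (by simp only [freq_8, table]; norm_num)
    (showdownFreq_lt (by norm_num) countMasks_8 freq_8 (by decide +kernel))

lemma countMasks_9 :
    ∀ k < 8, countMasks (maskStraight 9) 9 k 0 = fiveSixSeven 6 19 21 k := by
  decide +kernel

lemma freq_9 : ∀ h, freq 9 h =
    table 8347680 7757856 4016160 1322784 1213440 186120 645408 44640 10560 h :=
  freq_eq_of_handCount (by norm_num) countMasks_9 (by decide +kernel)

lemma showdownFreq_9_onePair_lt_twoPair :
    showdownFreq 9 (freqRanking 9) .onePair < showdownFreq 9 (freqRanking 9) .twoPair :=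
  showdownFreq_lt (by norm_num) countMasks_9 freq_9 (by decide +kernel)

lemma showdownFreq_9_threeOfAKind_lt_fullHouse :
    showdownFreq 9 (freqRanking 9) .threeOfAKind < showdownFreq 9 (freqRanking 9) .fullHouse :=
  showdownFreq_lt (by norm_num) countMasks_9 freq_9 (by decide +kernel)

lemma not_agreeExceptHighCard_9 :
    ¬ AgreeExceptHighCard (showdownRanking 9 (freqRanking 9)) (freqRanking 9) :=
  not_agreeExceptHighCard (h₀ := .onePair) (h₁ := .twoPair) (by decide) (by decide)
    (by simp only [freq_9, table]; norm_num)
    showdownFreq_9_onePair_lt_twoPair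

lemma countMasks_10 :
    ∀ k < 8, countMasks (maskStraight 10) 10 k 0 = fiveSixSeven 7 29 46 k := by
  decide +kernel

lemma freq_10 : ∀ h, freq 10 h =
    table 18643560 16677480 7645800 2404200 2019840 464160 1060200 71400 15844 h :=
  freq_eq_of_handCount (by norm_num) countMasks_10 (by decide +kernel)

lemma not_agreeExceptHighCard_10 :
    ¬ AgreeExceptHighCard (showdownRanking 10 (freqRanking 10)) (freqRanking 10) :=
  not_agreeExceptHighCard (h₀ := .threeOfAKind) (h₁ := .straight) (by decide) (by decide)
    (by simp only [freq_10, table]; norm_num)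
    (showdownFreq_lt (by norm_num) countMasks_10 freq_10 (by decide +kernel))

lemma countMasks_11 :
    ∀ k < 8, countMasks (maskStraight 11) 11 k 0 = fiveSixSeven 8 41 85 k := by
  decide +kernel

lemma freq_11 : ∀ h, freq 11 h =
    table 38320568 32913848 13517240 4097720 3129344 1038048 1647800 108680 22648 h :=
  freq_eq_of_handCount (by norm_num) countMasks_11 (by decide +kernel)

lemma not_agreeExceptHighCard_11 :
    ¬ AgreeExceptHighCard (showdownRanking 11 (freqRanking 11)) (freqRanking 11) :=
  not_agreeExceptHighCard (h₀ := .threeOfAKind) (h₁ := .straight) (by decide) (by decide)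
    (by simp only [freq_11, table]; norm_num)
    (showdownFreq_lt (by norm_num) countMasks_11 freq_11 (by decide +kernel))

lemma countMasks_12 :
    ∀ k < 8, countMasks (maskStraight 12) 12 k 0 = fiveSixSeven 9 55 141 k := by
  decide +kernel

lemma freq_12 : ∀ h, freq 12 h =
    table 73629072 60652944 22535568 6632208 4591104 2132064 2450448 158928 31164 h :=
  freq_eq_of_handCount (by norm_num) countMasks_12 (by decide +kernel)

lemma not_agreeExceptHighCard_12 :
    ¬ AgreeExceptHighCard (showdownRanking 12 (freqRanking 12)) (freqRanking 12) :=
  not_agreeExceptHighCard (h₀ := .threeOfAKind) (h₁ := .straight) (by decide) (by decide)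
    (by simp only [freq_12, table]; norm_num)
    (showdownFreq_lt (by norm_num) countMasks_12 freq_12 (by decide +kernel))

lemma countMasks_13 :
    ∀ k < 8, countMasks (maskStraight 13) 13 k 0 = fiveSixSeven 10 71 217 k := by
  decide +kernel

lemma freq_13 : ∀ h, freq 13 h =
    table 133784560 105669616 35821552 10287472 6454272 4089228 3514992 224848 41584 h :=
  freq_eq_of_handCount (by norm_num) countMasks_13 (by decide +kernel)

lemma showdownFreq_13 : ∀ h, showdownFreq 13 (freqRanking 13) h =
    table 23294460 58627800 31433400 6461620 6180020 4047644 3473184 224848 41584 h :=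
  showdownFreq_eq_of_handCount (by norm_num) countMasks_13 freq_13 (by decide +kernel)

end Poker

theorem mainTheorem4 :
    IsLeast
      {r : ℕ | 5 ≤ r ∧ Poker.AgreeExceptHighCard
        (Poker.showdownRanking r (Poker.freqRanking r)) (Poker.freqRanking r)} 13 ∧
    Poker.showdownRanking 13 (Poker.freqRanking 13) ≠ Poker.freqRanking 13 ∧
    (Poker.freqRanking 9 .twoPair .onePair ∧
      Poker.showdownFreq 9 (Poker.freqRanking 9) .onePair <
        Poker.showdownFreq 9 (Poker.freqRanking 9) .twoPair) ∧
    (Poker.freqRanking 9 .fullHouse .threeOfAKind ∧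
      Poker.showdownFreq 9 (Poker.freqRanking 9) .threeOfAKind <
        Poker.showdownFreq 9 (Poker.freqRanking 9) .fullHouse) := by
  have agree13 : Poker.AgreeExceptHighCard
      (Poker.showdownRanking 13 (Poker.freqRanking 13)) (Poker.freqRanking 13) := by
    intro h₀ h₁ hh₀ hh₁
    simp only [Poker.showdownRanking, Poker.freqRanking, Poker.showdownFreq_13, Poker.freq_13]
    cases h₀ <;> cases h₁ <;> first | contradiction | decide
  refine ⟨⟨⟨by norm_num, agree13⟩, fun r ⟨hr, hagree⟩ => ?_⟩, fun heq => ?_,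
    ⟨?_, Poker.showdownFreq_9_onePair_lt_twoPair⟩,
    ⟨?_, Poker.showdownFreq_9_threeOfAKind_lt_fullHouse⟩⟩
  · by_contra hlt
    push Not at hlt
    interval_cases r
    · exact Poker.not_agreeExceptHighCard_5 hagree
    · exact Poker.not_agreeExceptHighCard_6 hagree
    · exact Poker.not_agreeExceptHighCard_7 hagree
    · exact Poker.not_agreeExceptHighCard_8 hagree
    · exact Poker.not_agreeExceptHighCard_9 hagree
    · exact Poker.not_agreeExceptHighCard_10 hagree
    · exact Poker.not_agreeExceptHighCard_11 hagree
    · exact Poker.not_agreeExceptHighCard_12 hagree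
  · -- The high card is shown down less often than one pair, although it is more frequent.
    have h := congrFun₂ heq .highCard .onePair
    simp only [Poker.showdownRanking, Poker.freqRanking, Poker.showdownFreq_13, Poker.freq_13,
      Poker.table] at h
    norm_num at h
  · simp only [Poker.freqRanking, Poker.freq_9, Poker.table]
    norm_num
  · simp only [Poker.freqRanking, Poker.freq_9, Poker.table]
    norm_num
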